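/- \textbf{Setting.} Let $r\ge 2$, let $\Gamma$ be an infinite group generated by a finite set $S$, with identity $e$ and word metric $d$. Let $G=\mathbb{Z}_r\wr\Gamma$ be the group of pairs $(\eta,x)$, with $x\in\Gamma$ and $\eta:\Gamma\to\mathbb{Z}_r$ finitely supported, under $(\eta,x)(\eta',x')=(\eta+T_x\eta',xx')$, where $(T_x\eta')(y)=\eta'(x^{-1}y)$. Fix $c>0$ and put $d_G((\eta,x),(\eta',x'))=l+c\cdot\#\{y:\eta(y)\ne\eta'(y)\}$, where $l$ is the smallest length of a tour in the Cayley graph of $\Gamma$ from $x$ to $x'$ that visits every $y$ with $\eta(y)\neq\eta'(y)$. Let $\widehat\Gamma=\Gamma\cup\partial\Gamma$ be a metrizable space (disjoint union; not necessarily compact) that contains $\Gamma$ as a set of isolated points, such that the action of $\Gamma$ on itself by left translation extends to an action on $\widehat\Gamma$ by homeomorphisms. For $\mathfrak u\in\partial\Gamma$ let $\mathcal C_{\mathfrak u}$ be the set of all $\zeta:\Gamma\to\mathbb{Z}_r$ that are finitely supported or whose support has $\mathfrak u$ as its only accumulation point in $\widehat\Gamma$. Let $$\Omega=\bigcup_{\mathfrak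 u\in\partial\Gamma}\mathcal C_{\mathfrak u}\times\{\mathfrak u\}\subset \mathbb{Z}_r^{\Gamma}\times\widehat\Gamma,$$ where $\mathbb{Z}_r^\Gamma$ carries the topology of pointwise convergence, the product carries the product topology, and $\Omega$ carries the subspace topology and its Borel $\sigma$-algebra. Let $\mu$ be a probability measure on $G$ whose support generates $G$ as a group and which has finite first moment, $\sum_g d_G(\mathrm{id},g)\mu(g)<\infty$. Let $\xi_1,\xi_2,\dots$ be i.i.d. with law $\mu$; the random walk $Z_n=(\eta_n,X_n)$ started at $g\in G$ is $Z_n=g\,\xi_1\cdots\xi_n$, and $X_n$ is a random walk on $\Gamma$ with law $\nu(x)=\sum_\eta\mu(\eta,x)$. \textbf{Basic assumptions.} (a) $\nu$ has finite first moment, $\sum_x d(e,x)\nu(x)<\infty$. (b) For every starting point in $\Gamma$ there is a $\partial\Gamma$-valued random variable $X_\infty$ such that $X_n\to X_\infty$ in $\widehat\Gamma$ almost surely. (c) (CP) Whenever $(x_n),(y_n)$ are sequences in $\Gamma$ with $x_n\neq e$ such that $\mathfrak u\in\partial\Gamma$ is an accumulation point of $(x_n)$ and $d(x_n,y_n)/d(x_n,e)\to0$,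 then $\mathfrak u$ is an accumulation point of $(y_n)$. Moreover, the rate of escape $m=\lim_n \frac1n\mathbb{E}[d(e,X_n)]$ of $X_n$ started at $e$ is positive. \textbf{Theorem.} For every starting point $g\in G$ there is an $\Omega$-valued random variable $Z_\infty=(\eta_\infty,X_\infty)$ such that $Z_n\to Z_\infty$ in $\mathbb{Z}_r^{\Gamma}\times\widehat\Gamma$ almost surely. In particular, $\eta_n\to\eta_\infty$ pointwise and $\eta_\infty$ has no accumulation point other than $X_\infty$. Moreover, the distribution of $Z_\infty$ is a continuous measure on $\Omega$: $\mathbb{P}[Z_\infty=z]=0$ for every $z\in\Omega$. -/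

import Mathlib

open Filter Topology MeasureTheory ProbabilityTheory

noncomputable section

namespace Lamplighter

/-! ### The wreath product `ℤ_r ≀ Γ` -/

/-- Elements `(η, x)` of the (restricted) wreath product `ℤ_r ≀ Γ`: a finitely supported lamp
configuration `η` and a position `x`. -/
@[ext]
structure LampGroup (r : ℕ) (Γ : Type*) where
  lamps : Γ →₀ ZMod r
  pos : Γ

section Group

variable {r : ℕ} {Γ : Type*} [Group Γ]

/-- The translation `(T_x η)(y) = η (x⁻¹ y)` of finitely supported configurations. -/
def translate (x : Γ) (η : Γ →₀ ZMod r) : Γ →₀ ZMod r :=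
  Finsupp.equivMapDomain (Equiv.mulLeft x) η

@[simp]
theorem translate_apply (x : Γ) (η : Γ →₀ ZMod r) (y : Γ) :
    translate x η y = η (x⁻¹ * y) := by
  simp [translate, Finsupp.equivMapDomain_apply]

/-- `(η, x) (η', x') = (η ⊕ T_x η', x x')`. -/
instance : Mul (LampGroup r Γ) :=
  ⟨fun g h => ⟨g.lamps + translate g.pos h.lamps, g.pos * h.pos⟩⟩

instance : One (LampGroup r Γ) := ⟨⟨0, 1⟩⟩

instance : Inv (LampGroup r Γ) :=
  ⟨fun g => ⟨-translate g.pos⁻¹ g.lamps, g.pos⁻¹⟩⟩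

@[simp]
theorem mul_lamps (g h : LampGroup r Γ) : (g * h).lamps = g.lamps + translate g.pos h.lamps := rfl

@[simp]
theorem mul_pos (g h : LampGroup r Γ) : (g * h).pos = g.pos * h.pos := rfl

@[simp]
theorem one_lamps : (1 : LampGroup r Γ).lamps = 0 := rfl

@[simp]
theorem one_pos : (1 : LampGroup r Γ).pos = 1 := rfl

@[simp]
theorem inv_lamps (g : LampGroup r Γ) : (g⁻¹).lamps = -translate g.pos⁻¹ g.lamps := rfl

@[simp]
theorem inv_pos (g : LampGroup r Γ) : (g⁻¹).pos = g.pos⁻¹ := rfl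

instance : Group (LampGroup r Γ) :=
  Group.ofLeftAxioms
    (fun a b c => by
      ext
      · simp [mul_assoc, add_assoc]
      · simp [mul_assoc])
    (fun a => by
      ext
      · simp
      · simp)
    (fun a => by
      ext
      · simp
      · simp)

end Group

/-- The lamplighter group carries the discrete σ-algebra. -/
instance (r : ℕ) (Γ : Type*) : MeasurableSpace (LampGroup r Γ) := ⊤

/-! ### Metrics -/

section Metric

variable {Γ : Type*} [Group Γ]

/-- The word metric: the graph distance in the Cayley graph of `Γ` with respect to `S`. -/
def wordDist (S : Set Γ) (x y : Γ) : ℕ := (SimpleGraph.mulCayley S).dist x y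

/-- The length of a tour, given as the list of the points visited successively. -/
def tourLength (S : Set Γ) : List Γ → ℕ
  | [] => 0
  | [_] => 0
  | x :: y :: l => wordDist S x y + tourLength S (y :: l)

/-- The smallest length of a "travelling salesman" tour from `x` to `x'` that visits every
element of `A`. -/
def travelLength (S : Set Γ) (A : Set Γ) (x x' : Γ) : ℕ :=
  sInf {n | ∃ l : List Γ, (∀ a ∈ A, a ∈ x :: (l ++ [x'])) ∧
    tourLength S (x :: (l ++ [x'])) = n}

/-- The lamplighter distance
`d_G((η, x), (η', x')) = l(x, x') + c · #{y : η y ≠ η' y}`, where the tour has to visit every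
element at which the two configurations differ. -/
def lampDist {r : ℕ} (S : Set Γ) (c : ℝ) (g h : LampGroup r Γ) : ℝ :=
  travelLength S {y | g.lamps y ≠ h.lamps y} g.pos h.pos
    + c * (Set.ncard {y | g.lamps y ≠ h.lamps y} : ℝ)

end Metric

/-- A law `p` has finite first moment with respect to the length function `len`. -/
def FiniteFirstMoment {α : Type*} (len : α → ℝ) (p : PMF α) : Prop :=
  Summable fun a => len a * (p a).toReal

/-! ### Random walks -/

/-- The random walk `Z_0 = g`, `Z_{n+1} = Z_n ξ_n` started at `g`, with increments `ξ`. -/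
def randomWalk {H W : Type*} [Mul H] (ξ : ℕ → W → H) (g : H) : ℕ → W → H
  | 0, _ => g
  | n + 1, ω => randomWalk ξ g n ω * ξ n ω

/-- The projection to `Γ` of the increments of a lamplighter random walk. -/
def posIncrement {r : ℕ} {Γ W : Type*} (ξ : ℕ → W → LampGroup r Γ) (n : ℕ) (ω : W) : Γ :=
  (ξ n ω).pos

theorem randomWalk_pos {r : ℕ} {Γ W : Type*} [Group Γ] (ξ : ℕ → W → LampGroup r Γ)
    (g : LampGroup r Γ) (n : ℕ) (ω : W) :
    (randomWalk ξ g n ω).pos = randomWalk (posIncrement ξ) g.pos n ω := by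
  induction n with
  | zero => rfl
  | succ n ih => simp [randomWalk, posIncrement, ih]

/-- The rate of escape `lim E[d(e, X_n)] / n` of the process `X` exists and is positive. -/
def PositiveRateOfEscape {Γ W : Type*} [Group Γ] [MeasurableSpace W] (S : Set Γ)
    (P : Measure W) (X : ℕ → W → Γ) : Prop :=
  ∃ m : ℝ, 0 < m ∧
    Tendsto (fun n : ℕ => (∫ ω, (wordDist S 1 (X n ω) : ℝ) ∂P) / n) atTop (𝓝 m)

/-! ### The extended space `Γ ∪ ∂Γ` -/

section Boundary

variable {Γ Γhat : Type*} [Group Γ] [TopologicalSpace Γhat] (ι : Γ → Γhat)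

/-- `Γhat`, with its action of `Γ`, extends the discrete space `Γ` (embedded by `ι`)
equivariantly. -/
structure IsExtendedSpace [MulAction Γ Γhat] : Prop where
  injective : Function.Injective ι
  isOpen_singleton : ∀ x : Γ, IsOpen {ι x}
  equivariant : ∀ γ x : Γ, ι (γ * x) = γ • ι x

/-- The boundary `∂Γ = Γhat \ Γ`. -/
def boundary : Set Γhat := (Set.range ι)ᶜ

/-- The convergence property (CP). -/
def ConvergenceProperty (S : Set Γ) : Prop :=
  ∀ (x y : ℕ → Γ) (u : Γhat), u ∈ boundary ι → (∀ n, x n ≠ 1) →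
    MapClusterPt u atTop (fun n => ι (x n)) →
    Tendsto (fun n => (wordDist S (x n) (y n) : ℝ) / wordDist S (x n) 1) atTop (𝓝 0) →
    MapClusterPt u atTop (fun n => ι (y n))

/-- The basic assumptions on a random walk on `Γ` with law `ν`; `X x` is the walk started
at `x`. -/
structure BasicAssumptions [MeasurableSpace Γhat] {W : Type*} [MeasurableSpace W] (S : Set Γ)
    (P : Measure W) (ν : PMF Γ) (X : Γ → ℕ → W → Γ) : Prop where
  finite_first_moment : FiniteFirstMoment (fun x => (wordDist S 1 x : ℝ)) ν
  converges : ∀ x : Γ, ∃ Xinf : W → boundary ι, Measurable Xinf ∧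
    ∀ᵐ ω ∂P, Tendsto (fun n => ι (X x n ω)) atTop (𝓝 (Xinf ω : Γhat))
  convergence_property : ConvergenceProperty ι S

/-- The set `C_u` of the configurations that are finitely supported or whose support has `u` as
its only accumulation point in `Γhat`. -/
def configsAt (r : ℕ) (u : Γhat) : Set (Γ → ZMod r) :=
  {ζ | (Function.support ζ).Finite ∨
    ∀ v : Γhat, AccPt v (𝓟 (ι '' Function.support ζ)) ↔ v = u}

/-- `Ω = ⋃_{u ∈ ∂Γ} C_u × {u}`, a subset of all configurations times `Γhat`; its topology and
σ-algebra are those of a subspace of the product. -/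
def lampBoundary (r : ℕ) : Set ((Γ → ZMod r) × Γhat) :=
  {p | p.2 ∈ boundary ι ∧ p.1 ∈ configsAt ι r p.2}

/-- The inclusion of the lamplighter group into all configurations times `Γhat`. -/
def embed {r : ℕ} (g : LampGroup r Γ) : (Γ → ZMod r) × Γhat := (⇑g.lamps, ι g.pos)

end Boundary

end Lamplighter

end

/-! Positive speed beats sublinear jumps. The length `L g = d(e, pos g)` is subadditive, and its
mean along the walk grows linearly. A one-sided version of the subadditive ergodic theorem
(`IsLength.ae_linearGrowth`) turns this into almost sure growth `d(e, X_n) ≥ n / k` with a random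
`k`. Finite first moment and the strong law give `d_G(id, ξ_n) = o(n)`. The `n`-th increment only
changes lamps within distance `d_G(id, ξ_n)` of `X_n`, because the tour in `d_G` visits every
changed lamp. Hence each lamp is changed finitely often and `η_n` converges pointwise.

If points `y_j` of the limiting support leave every finite set, let `N_j` be a time at which the
lamp at `y_j` changes. Then `N_j → ∞` and `d(X_{N_j}, y_j) / d(X_{N_j}, e) → 0`, so (CP) makes `X_∞`
an accumulation point of `(y_j)`. This identifies the accumulation points of the support, with no
compactness needed.

For continuity, let `p(z)` be the probability that the walk from the identity converges to `z`. It
is harmonic: `p(z) = ∑ ν(g) p(g⁻¹ z)`. If `p` is not identically zero, it attains its maximum on a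
finite nonempty set, and the maximum principle makes this set invariant under the group generated by
the support. All orbits are infinite, since a single lamp can be altered anywhere, so `p = 0`. -/

noncomputable section

namespace Lamplighter

/-! ### Shifts of i.i.d. sequences -/

section Shift

variable {H : Type*}

/-- The sequence `s` without its first `k` terms. -/
def shiftSeq (k : ℕ) (s : ℕ → H) : ℕ → H := fun i => s (k + i)

theorem shiftSeq_shiftSeq (k l : ℕ) (s : ℕ → H) :
    shiftSeq l (shiftSeq k s) = shiftSeq (k + l) s := by
  funext i; simp [shiftSeq, add_assoc]

@[simp]
theorem shiftSeq_zero (s : ℕ → H) : shiftSeq 0 s = s := by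
  funext i; simp [shiftSeq]

variable [MeasurableSpace H]

theorem measurable_shiftSeq (k : ℕ) : Measurable (shiftSeq k : (ℕ → H) → ℕ → H) :=
  measurable_pi_iff.2 fun i => measurable_pi_apply (k + i)

/-- Such an event depends only on the increments from time `k` on; this serves both the zero-one law
and the Markov property. -/
theorem measurableSet_shiftSeq_preimage {E : Set (ℕ → H)} (hE : MeasurableSet E) (k : ℕ) :
    MeasurableSet[⨆ i ∈ Set.Ici k, MeasurableSpace.comap (fun s : ℕ → H => s i) inferInstance]
      (shiftSeq k ⁻¹' E) := by
  refine (@measurable_pi_lambda _ _ _ (_) _ _ fun i => ?_) hE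
  refine Measurable.mono (comap_measurable (fun s : ℕ → H => s (k + i))) ?_ le_rfl
  exact le_iSup₂_of_le (f := fun i (_ : i ∈ Set.Ici k) =>
    MeasurableSpace.comap (fun s : ℕ → H => s i) inferInstance) (k + i) (by simp) le_rfl

variable (ν : Measure H) [IsProbabilityMeasure ν]

/-- The law of a sequence of independent increments. -/
abbrev pathMeasure : Measure (ℕ → H) := Measure.infinitePi fun _ => ν

theorem measurePreserving_shiftSeq (k : ℕ) :
    MeasurePreserving (shiftSeq k) (pathMeasure ν) (pathMeasure ν) :=
  ⟨measurable_shiftSeq k, Measure.map_infinitePi_infinitePi_of_inj (P := fun _ : ℕ => ν)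
    (f := fun i => k + i) (add_right_injective k)⟩

theorem iIndep_coordinates : iIndep
    (fun i => MeasurableSpace.comap (fun s : ℕ → H => s i) inferInstance) (pathMeasure ν) :=
  iIndepFun_infinitePi (P := fun _ : ℕ => ν) (X := fun _ x => x) fun _ => measurable_id

/-- The Markov property at time one: the first increment is independent of the remaining ones, whose
joint law is unchanged by the shift. -/
theorem pathMeasure_head_inter_tail [MeasurableSingletonClass H] (g : H) {E : Set (ℕ → H)}
    (hE : MeasurableSet E) :
    pathMeasure ν {s | s 0 = g ∧ shiftSeq 1 s ∈ E} = ν {g} * pathMeasure ν E := by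
  have h := indep_iSup_of_disjoint (m := fun i => MeasurableSpace.comap (fun s : ℕ → H => s i)
    inferInstance) (fun i => (measurable_pi_apply i).comap_le) (iIndep_coordinates ν)
    (S := {0}) (T := Set.Ici 1) (by simp)
  have h1 : MeasurableSet[⨆ i ∈ ({0} : Set ℕ), MeasurableSpace.comap (fun s : ℕ → H => s i)
      inferInstance] ((fun s : ℕ → H => s 0) ⁻¹' {g}) := by
    refine le_iSup₂_of_le (f := fun i (_ : i ∈ ({0} : Set ℕ)) =>
      MeasurableSpace.comap (fun s : ℕ → H => s i) inferInstance) 0 rfl le_rfl _ ?_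
    exact ⟨{g}, measurableSet_singleton g, rfl⟩
  have h2 := (Indep_iff _ _ _).1 h _ _ h1 (measurableSet_shiftSeq_preimage hE 1)
  rw [(measurePreserving_shiftSeq ν 1).measure_preimage hE.nullMeasurableSet,
    (measurePreserving_eval_infinitePi (fun _ : ℕ => ν) 0).measure_preimage
      (measurableSet_singleton g).nullMeasurableSet] at h2
  exact h2

theorem integrable_coordinate {L : H → ℝ} (hint : Integrable L ν) (i : ℕ) :
    Integrable (fun s : ℕ → H => L (s i)) (pathMeasure ν) :=
  (measurePreserving_eval_infinitePi (fun _ : ℕ => ν) i).integrable_comp_of_integrable hint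

end Shift

/-! ### Walks along deterministic increments and length functions -/

section PathWalk

variable {H : Type*} [Group H]

/-- The walk started at `g` along a fixed sequence `s` of increments. -/
def pathWalk (s : ℕ → H) (g : H) : ℕ → H
  | 0 => g
  | n + 1 => pathWalk s g n * s n

theorem randomWalk_eq_pathWalk {W : Type*} (ξ : ℕ → W → H) (g : H) (n : ℕ) (ω : W) :
    randomWalk ξ g n ω = pathWalk (fun k => ξ k ω) g n := by
  induction n with
  | zero => rfl
  | succ n ih => simp [randomWalk, pathWalk, ih]

theorem pathWalk_mul (s : ℕ → H) (g h : H) (n : ℕ) :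
    pathWalk s (g * h) n = g * pathWalk s h n := by
  induction n with
  | zero => rfl
  | succ n ih => simp [pathWalk, ih, mul_assoc]

theorem pathWalk_eq_mul (s : ℕ → H) (g : H) (n : ℕ) : pathWalk s g n = g * pathWalk s 1 n := by
  rw [← pathWalk_mul, mul_one]

theorem pathWalk_add (s : ℕ → H) (g : H) (n l : ℕ) :
    pathWalk s g (n + l) = pathWalk s g n * pathWalk (shiftSeq n s) 1 l := by
  induction l with
  | zero => simp [pathWalk]
  | succ l ih => rw [← add_assoc]; simp [pathWalk, ih, mul_assoc, shiftSeq]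

theorem pathWalk_succ' (s : ℕ → H) (n : ℕ) :
    pathWalk s 1 (n + 1) = s 0 * pathWalk (shiftSeq 1 s) 1 n := by
  rw [add_comm, pathWalk_add]
  simp [pathWalk]

/-- A (pseudo-)length function on a group. -/
structure IsLength (L : H → ℝ) : Prop where
  one : L 1 = 0
  nonneg : ∀ x, 0 ≤ L x
  mul_le : ∀ x y, L (x * y) ≤ L x + L y
  inv : ∀ x, L x⁻¹ = L x

variable {L : H → ℝ}

theorem IsLength.le_mul_add (hL : IsLength L) (x y : H) : L y ≤ L (x * y) + L x := by
  have := hL.mul_le x⁻¹ (x * y)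
  rw [inv_mul_cancel_left, hL.inv] at this
  linarith

theorem IsLength.pathWalk_le_sum (hL : IsLength L) (s : ℕ → H) (n : ℕ) :
    L (pathWalk s 1 n) ≤ ∑ i ∈ Finset.range n, L (s i) := by
  induction n with
  | zero => simp [pathWalk, hL.one]
  | succ n ih =>
    rw [Finset.sum_range_succ]
    exact (hL.mul_le _ _).trans (by gcongr)

/-- The greedy decomposition behind the lower bound in the subadditive ergodic theorem. -/
theorem IsLength.pathWalk_le_greedy (hL : IsLength L) (s : ℕ → H) {ε : ℝ} (hε : 0 ≤ ε) (N : ℕ)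
    (B : Set ℕ)
    (hB : ∀ k, k ∉ B → ∃ l, 1 ≤ l ∧ l ≤ N ∧ L (pathWalk (shiftSeq k s) 1 l) ≤ l * ε) (M : ℕ) :
    ∀ n k, k + n = M → L (pathWalk (shiftSeq k s) 1 n) ≤ n * ε +
      ∑ i ∈ Finset.Ico k M, (B.indicator (fun i => L (s i)) i
        + if M ≤ i + N then L (s i) else 0) := by
  set w : ℕ → ℝ := fun i => B.indicator (fun i => L (s i)) i + if M ≤ i + N then L (s i) else 0
    with hw
  have hw0 : ∀ i, 0 ≤ w i := by
    intro i
    have h1 : 0 ≤ B.indicator (fun i => L (s i)) i :=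
      Set.indicator_nonneg (fun _ _ => hL.nonneg _) _
    have h2 : 0 ≤ if M ≤ i + N then L (s i) else 0 := by
      split_ifs
      · exact hL.nonneg _
      · exact le_rfl
    exact add_nonneg h1 h2
  intro n
  induction n using Nat.strong_induction_on with
  | _ n ih =>
    intro k hk
    rcases Nat.eq_zero_or_pos n with rfl | hn
    · have : 0 ≤ ∑ i ∈ Finset.Ico k M, w i := Finset.sum_nonneg fun i _ => hw0 i
      simpa [pathWalk, hL.one] using this
    -- At a bad time, advance by one increment and pay its full length. At a good time, jump over a
    -- block of speed at most `ε`.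
    by_cases hkB : k ∈ B
    · obtain ⟨n, rfl⟩ : ∃ m, n = m + 1 := ⟨n - 1, by omega⟩
      have h1 := ih n (by omega) (k + 1) (by omega)
      rw [Finset.sum_eq_sum_Ico_succ_bot (by omega : k < M), pathWalk_succ', shiftSeq_shiftSeq]
      have h2 := hL.mul_le (shiftSeq k s 0) (pathWalk (shiftSeq (k + 1) s) 1 n)
      have h3 : L (shiftSeq k s 0) ≤ w k := by
        simp only [hw, shiftSeq, add_zero, Set.indicator_of_mem hkB]
        have h2 : 0 ≤ if M ≤ k + N then L (s k) else 0 := by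
          split_ifs
          · exact hL.nonneg _
          · exact le_rfl
        linarith
      push_cast
      linarith
    · obtain ⟨l, hl1, hlN, hl⟩ := hB k hkB
      rcases le_or_gt l n with hln | hln
      · obtain ⟨p, rfl⟩ := Nat.exists_eq_add_of_le hln
        have h1 := ih p (by omega) (k + l) (by omega)
        rw [pathWalk_add, shiftSeq_shiftSeq]
        have h2 := hL.mul_le (pathWalk (shiftSeq k s) 1 l) (pathWalk (shiftSeq (k + l) s) 1 p)
        have h3 : ∑ i ∈ Finset.Ico (k + l) M, w i ≤ ∑ i ∈ Finset.Ico k M, w i :=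
          Finset.sum_le_sum_of_subset_of_nonneg
            (Finset.Ico_subset_Ico_left (by omega)) fun i _ _ => hw0 i
        push_cast
        linarith
      -- The slow block would overshoot `M`, so every remaining index lies within `N` of `M` and the
      -- second summand of `w` pays for it.
      · have h1 := hL.pathWalk_le_sum (shiftSeq k s) n
        have h2 : ∑ i ∈ Finset.range n, L (shiftSeq k s i) ≤ ∑ i ∈ Finset.Ico k M, w i := by
          rw [Finset.sum_Ico_eq_sum_range, show M - k = n by omega]
          refine Finset.sum_le_sum fun i _ => ?_
          have h3 : 0 ≤ B.indicator (fun i => L (s i)) (k + i) :=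
            Set.indicator_nonneg (fun _ _ => hL.nonneg _) _
          simp only [hw, shiftSeq]
          rw [if_pos (by omega)]
          linarith
        have : 0 ≤ n * ε := by positivity
        linarith

/-- The length of the walk along `s` grows at least linearly. -/
def LinearGrowth (L : H → ℝ) (s : ℕ → H) : Prop :=
  ∃ k N : ℕ, ∀ n ≥ N, (n : ℝ) ≤ k * L (pathWalk s 1 n)

/-- Removing the first increment alters lengths by a bounded amount. Doubling `k` absorbs this error
once `n ≥ 2kC + 2`. -/
theorem IsLength.linearGrowth_shiftSeq_one (hL : IsLength L) (s : ℕ → H) :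
    LinearGrowth L (shiftSeq 1 s) ↔ LinearGrowth L s := by
  obtain ⟨C, hC⟩ := exists_nat_ge (L (s 0))
  constructor
  · rintro ⟨k, N, h⟩
    refine ⟨2 * k, N + 2 * k * C + 2, fun n hn => ?_⟩
    obtain ⟨n, rfl⟩ : ∃ m, n = m + 1 := ⟨n - 1, by omega⟩
    have h1 := h n (by nlinarith)
    have h2 := hL.le_mul_add (s 0) (pathWalk (shiftSeq 1 s) 1 n)
    rw [← pathWalk_succ'] at h2
    have h3 : ((N + 2 * k * C + 2 : ℕ) : ℝ) ≤ ((n + 1 : ℕ) : ℝ) := by exact_mod_cast hn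
    have h4 : (k : ℝ) * L (pathWalk (shiftSeq 1 s) 1 n) ≤ k * (L (pathWalk s 1 (n + 1)) + C) := by
      gcongr
      linarith
    push_cast at h3 ⊢
    have : (0 : ℝ) ≤ N := by positivity
    nlinarith
  · rintro ⟨k, N, h⟩
    refine ⟨2 * k, N + 2 * k * C + 2, fun n hn => ?_⟩
    have h1 := h (n + 1) (by nlinarith)
    have h2 := hL.mul_le (s 0) (pathWalk (shiftSeq 1 s) 1 n)
    rw [← pathWalk_succ'] at h2
    have h3 : ((N + 2 * k * C + 2 : ℕ) : ℝ) ≤ (n : ℝ) := by exact_mod_cast hn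
    have h4 : (k : ℝ) * L (pathWalk s 1 (n + 1)) ≤
        k * (L (pathWalk (shiftSeq 1 s) 1 n) + C) := by
      gcongr
      linarith
    push_cast at h1 h3 ⊢
    have : (0 : ℝ) ≤ N := by positivity
    nlinarith

theorem IsLength.linearGrowth_shiftSeq (hL : IsLength L) (j : ℕ) (s : ℕ → H) :
    LinearGrowth L (shiftSeq j s) ↔ LinearGrowth L s := by
  induction j with
  | zero => simp
  | succ j ih => rw [← shiftSeq_shiftSeq, hL.linearGrowth_shiftSeq_one, ih]

end PathWalk

/-! ### From linear growth in mean to almost sure linear growth -/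

section Measure

variable {H : Type*} [Group H] [MeasurableSpace H] (ν : Measure H) [IsProbabilityMeasure ν]

variable [DiscreteMeasurableSpace H] [Countable H]

theorem measurable_pathWalk (g : H) (n : ℕ) : Measurable fun s : ℕ → H => pathWalk s g n := by
  induction n with
  | zero => exact measurable_const
  | succ n ih => exact ih.mul (measurable_pi_apply n)

variable {L : H → ℝ}

theorem measurableSet_linearGrowth : MeasurableSet {s : ℕ → H | LinearGrowth L s} := by
  simp only [LinearGrowth, Set.ofPred_exists, Set.ofPred_forall]
  refine .iUnion fun k => .iUnion fun N => .iInter fun n => .iInter fun _ => ?_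
  exact measurableSet_le measurable_const
    (measurable_const.mul (Measurable.of_discrete.comp (measurable_pathWalk 1 n)))

/-- Kolmogorov's zero-one law: by shift invariance the event is measurable with respect to every
tail. -/
theorem IsLength.linearGrowth_zero_or_one (hL : IsLength L) :
    pathMeasure ν {s | LinearGrowth L s} = 0 ∨ pathMeasure ν {s | LinearGrowth L s} = 1 := by
  refine measure_zero_or_one_of_measurableSet_limsup_atTop
    (fun i => (measurable_pi_apply i).comap_le) (iIndep_coordinates ν) ?_
  rw [limsup_eq_iInf_iSup_of_nat, MeasurableSpace.measurableSet_iInf]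
  intro k
  have h : {s : ℕ → H | LinearGrowth L s} = shiftSeq k ⁻¹' {s | LinearGrowth L s} := by
    ext s; exact (hL.linearGrowth_shiftSeq k s).symm
  rw [h]
  exact measurableSet_shiftSeq_preimage measurableSet_linearGrowth k

theorem IsLength.integrable_pathWalk (hL : IsLength L) (hint : Integrable L ν) (n : ℕ) :
    Integrable (fun s : ℕ → H => L (pathWalk s 1 n)) (pathMeasure ν) := by
  refine Integrable.mono' (integrable_finsetSum (Finset.range n)
    fun i _ => integrable_coordinate ν hint i) ?_ (.of_forall fun s => ?_)
  · exact (Measurable.of_discrete.comp (measurable_pathWalk 1 n)).aestronglyMeasurable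
  · rw [Real.norm_of_nonneg (hL.nonneg _)]
    exact hL.pathWalk_le_sum s n

/-- The sequences along which the walk moves faster than `ε` up to time `N`. -/
def fastUpTo (L : H → ℝ) (ε : ℝ) (N : ℕ) : Set (ℕ → H) :=
  {s | ∀ l, 1 ≤ l → l ≤ N → l * ε < L (pathWalk s 1 l)}

theorem measurableSet_fastUpTo (ε : ℝ) (N : ℕ) : MeasurableSet (fastUpTo (H := H) L ε N) := by
  simp only [fastUpTo, Set.ofPred_forall]
  refine .iInter fun n => .iInter fun _ => .iInter fun _ => ?_
  exact measurableSet_lt measurable_const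
    (Measurable.of_discrete.comp (measurable_pathWalk 1 n))

/-- Integrate the greedy bound, a time being bad when the walk restarted there stays fast up to `N`.
By stationarity each bad time has the same expected cost, and at most `N` final indices pay the
boundary term. -/
theorem IsLength.integral_pathWalk_le (hL : IsLength L) (hint : Integrable L ν) {ε : ℝ}
    (hε : 0 ≤ ε) (N n : ℕ) :
    ∫ s, L (pathWalk s 1 n) ∂(pathMeasure ν) ≤
      n * ε + n * ∫ s in fastUpTo L ε N, L (s 0) ∂(pathMeasure ν)
        + N * ∫ s, L (s 0) ∂(pathMeasure ν) := by
  set Q := pathMeasure ν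
  set E := fastUpTo L ε N
  have hE : MeasurableSet E := measurableSet_fastUpTo ε N
  set F : (ℕ → H) → ℝ := E.indicator fun s => L (s 0)
  have hF : Integrable F Q := (integrable_coordinate ν hint 0).indicator hE
  have hFi : ∀ i, Integrable (fun s => F (shiftSeq i s)) Q := fun i =>
    (measurePreserving_shiftSeq ν i).integrable_comp_of_integrable hF
  have hint_shift : ∀ i (f : (ℕ → H) → ℝ), Integrable f Q →
      ∫ s, f (shiftSeq i s) ∂Q = ∫ s, f s ∂Q := by
    intro i f hf
    have h := (measurePreserving_shiftSeq ν i).map_eq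
    rw [← integral_map (measurable_shiftSeq i).aemeasurable (by rw [h]; exact hf.1), h]
  have hbound : ∀ s, L (pathWalk s 1 n) ≤ n * ε + ∑ i ∈ Finset.range n,
      (F (shiftSeq i s) + if n ≤ i + N then L (s i) else 0) := by
    intro s
    have h := hL.pathWalk_le_greedy s hε N {k | shiftSeq k s ∈ E} (by
      intro k hk
      simpa [E, fastUpTo] using hk) n n 0 (by simp)
    rw [shiftSeq_zero, ← Finset.range_eq_Ico] at h
    refine h.trans (le_of_eq ?_)
    congr 1
  have hterm : ∀ i, Integrable (fun s : ℕ → H => if n ≤ i + N then L (s i) else 0) Q := by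
    intro i
    split_ifs
    · exact integrable_coordinate ν hint i
    · exact integrable_zero _ _ _
  have hsum : Integrable (fun s => ∑ i ∈ Finset.range n,
      (F (shiftSeq i s) + if n ≤ i + N then L (s i) else 0)) Q :=
    integrable_finsetSum _ fun i _ => (hFi i).add (hterm i)
  refine (integral_mono (hL.integrable_pathWalk ν hint n)
    ((integrable_const _).add hsum) hbound).trans ?_
  have hβ : 0 ≤ ∫ s, L (s 0) ∂Q := integral_nonneg fun s => hL.nonneg _
  have h1 : ∀ i, ∫ s, (if n ≤ i + N then L (s i) else 0) ∂Q =
      if n ≤ i + N then ∫ s, L (s 0) ∂Q else 0 := by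
    intro i
    split_ifs
    · exact hint_shift i (fun s => L (s 0)) (integrable_coordinate ν hint 0)
    · simp
  simp only [Pi.add_apply]
  rw [integral_add (integrable_const _) hsum, integral_finsetSum (f := fun i s =>
    F (shiftSeq i s) + if n ≤ i + N then L (s i) else 0) _ fun i _ => (hFi i).add (hterm i)]
  have h2 : ∀ i ∈ Finset.range n, ∫ s, (F (shiftSeq i s) + if n ≤ i + N then L (s i) else 0) ∂Q =
      ∫ s in E, L (s 0) ∂Q + if n ≤ i + N then ∫ s, L (s 0) ∂Q else 0 := by
    intro i _
    rw [integral_add (hFi i) (hterm i), h1, hint_shift i F hF, integral_indicator hE]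
  rw [Finset.sum_congr rfl h2, Finset.sum_add_distrib, ← Finset.sum_filter, Finset.sum_const,
    Finset.sum_const]
  have h3 : ((Finset.range n).filter fun i => n ≤ i + N).card ≤ N := by
    calc _ ≤ (Finset.Ico (n - N) n).card := by
          refine Finset.card_le_card fun i hi => ?_
          simp only [Finset.mem_filter, Finset.mem_range, Finset.mem_Ico] at hi ⊢
          omega
      _ ≤ N := by rw [Nat.card_Ico]; omega
  have h4 : (((Finset.range n).filter fun i => n ≤ i + N).card : ℝ) * ∫ s, L (s 0) ∂Q ≤
      N * ∫ s, L (s 0) ∂Q := by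
    gcongr
  simp only [integral_const, probReal_univ, smul_eq_mul, one_mul, Finset.card_range, nsmul_eq_mul]
  linarith

/-- A walk with positive mean rate of escape almost surely grows linearly. -/
theorem IsLength.ae_linearGrowth (hL : IsLength L) (hint : Integrable L ν) {m : ℝ} (hm : 0 < m)
    (hlim : Tendsto (fun n : ℕ => (∫ s, L (pathWalk s 1 n) ∂(pathMeasure ν)) / n) atTop (𝓝 m)) :
    ∀ᵐ s ∂(pathMeasure ν), LinearGrowth L s := by
  rcases hL.linearGrowth_zero_or_one ν with h | h
  swap
  · exact (prob_compl_eq_zero_iff measurableSet_linearGrowth).2 h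
  exfalso
  set Q := pathMeasure ν
  set ε := m / 2
  have hε : 0 < ε := by positivity
  -- Divide the integrated bound by `n` and let `n → ∞` with `N` fixed.
  have hle : ∀ N : ℕ, m ≤ ε + ∫ s in fastUpTo L ε N, L (s 0) ∂Q := by
    intro N
    have h1 : Tendsto (fun n : ℕ => ε + ∫ s in fastUpTo L ε N, L (s 0) ∂Q
        + (N * ∫ s, L (s 0) ∂Q) / n) atTop (𝓝 (ε + ∫ s in fastUpTo L ε N, L (s 0) ∂Q + 0)) :=
      tendsto_const_nhds.add (tendsto_const_div_atTop_nhds_zero_nat _)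
    rw [add_zero] at h1
    refine le_of_tendsto_of_tendsto hlim h1 ?_
    filter_upwards [eventually_gt_atTop 0] with n hn
    have hn' : (0 : ℝ) < n := by exact_mod_cast hn
    rw [div_le_iff₀ hn']
    refine (hL.integral_pathWalk_le ν hint hε.le N n).trans (le_of_eq ?_)
    rw [add_mul, div_mul_cancel₀ _ hn'.ne']
    ring
  have hlim0 : Tendsto (fun N : ℕ => ∫ s in fastUpTo L ε N, L (s 0) ∂Q) atTop
      (𝓝 (∫ s in ⋂ N, fastUpTo L ε N, L (s 0) ∂Q)) := by
    refine tendsto_setIntegral_of_antitone (fun N => measurableSet_fastUpTo ε N) ?_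
      ⟨0, (integrable_coordinate ν hint 0).integrableOn⟩
    intro N N' hN s hs l hl hl'
    exact hs l hl (hl'.trans hN)
  -- A walk that stays fast for all times grows linearly, with `k ≥ ε⁻¹`. If linear growth had
  -- probability zero, letting `N → ∞` would give `m ≤ ε = m / 2`.
  have hnull : Q (⋂ N, fastUpTo L ε N) = 0 := by
    refine measure_mono_null (fun s hs => ?_) h
    obtain ⟨k, hk⟩ := exists_nat_ge ε⁻¹
    refine ⟨k, 1, fun n hn => ?_⟩
    have h1 := (Set.mem_iInter.1 hs n) n hn le_rfl
    have h2 : (1 : ℝ) ≤ k * ε := by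
      calc (1 : ℝ) = ε⁻¹ * ε := (inv_mul_cancel₀ hε.ne').symm
        _ ≤ k * ε := by gcongr
    have h3 : (0 : ℝ) ≤ n := by positivity
    have h4 : (0 : ℝ) ≤ k := by positivity
    nlinarith
  rw [Measure.restrict_eq_zero.2 hnull, integral_zero_measure] at hlim0
  have := ge_of_tendsto' (tendsto_const_nhds.add hlim0) hle
  simp only [add_zero, ε] at this
  linarith

end Measure

/-! ### Sublinearity of integrable increments -/

section Sublinear

variable {H : Type*} [MeasurableSpace H] [DiscreteMeasurableSpace H] (ν : Measure H)
  [IsProbabilityMeasure ν] {f : H → ℝ}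

/-- The increments of a random walk are almost surely sublinear in an integrable size. -/
theorem ae_tendsto_coordinate_div (hint : Integrable f ν) :
    ∀ᵐ s ∂(pathMeasure ν), Tendsto (fun n : ℕ => f (s n) / n) atTop (𝓝 0) := by
  have hiid : iIndepFun (fun i (s : ℕ → H) => s i) (pathMeasure ν) :=
    iIndepFun_infinitePi (P := fun _ : ℕ => ν) (X := fun _ x => x) fun _ => measurable_id
  have hf : Measurable f := .of_discrete
  have h := strong_law_ae_real (μ := pathMeasure ν) (fun i s => f (s i))
    (integrable_coordinate ν hint 0)
    (fun i j hij => (hiid.indepFun hij).comp hf hf)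
    (fun i => IdentDistrib.comp (u := f) ⟨(measurable_pi_apply i).aemeasurable,
      (measurable_pi_apply 0).aemeasurable, by
        rw [(measurePreserving_eval_infinitePi (fun _ : ℕ => ν) i).map_eq,
          (measurePreserving_eval_infinitePi (fun _ : ℕ => ν) 0).map_eq]⟩ hf)
  filter_upwards [h] with s hs
  set a := ∫ s, f (s 0) ∂(pathMeasure ν)
  set A : ℕ → ℝ := fun n => (∑ i ∈ Finset.range n, f (s i)) / n
  -- The identity `f(s_n) / n = A_{n+1} (1 + 1/n) - A_n` expresses the increment through averages
  -- with a common limit.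
  have h1 : Tendsto (fun n => A (n + 1) * (1 + 1 / (n : ℝ)) - A n) atTop (𝓝 (a * (1 + 0) - a)) :=
    (((tendsto_add_atTop_iff_nat 1).2 hs).mul
      (tendsto_const_nhds.add tendsto_one_div_atTop_nhds_zero_nat)).sub hs
  rw [add_zero, mul_one, sub_self] at h1
  refine h1.congr' ?_
  filter_upwards [eventually_gt_atTop 0] with n hn
  have hn' : (n : ℝ) ≠ 0 := by positivity
  have hn2 : (n : ℝ) + 1 ≠ 0 := by positivity
  simp only [A, Finset.sum_range_succ]
  push_cast
  field_simp
  ring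

end Sublinear

/-! ### Harmonicity and absence of atoms -/

section Atoms

variable {H : Type*} [Group H] {X : Type*} [TopologicalSpace X]

/-- The sequences of increments along which the walk, mapped by `e`, converges to `z`. -/
def convergingTo (e : H → X) (z : X) : Set (ℕ → H) :=
  {s | Tendsto (fun n => e (pathWalk s 1 n)) atTop (𝓝 z)}

theorem mem_convergingTo_iff [MulAction H X] [ContinuousConstSMul H X] {e : H → X}
    (he : ∀ g h, e (g * h) = g • e h) (z : X) (s : ℕ → H) :
    s ∈ convergingTo e z ↔ shiftSeq 1 s ∈ convergingTo e ((s 0)⁻¹ • z) := by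
  have h : s ∈ convergingTo e z ↔ Tendsto (fun n => e (pathWalk s 1 (n + 1))) atTop (𝓝 z) :=
    (tendsto_add_atTop_iff_nat (f := fun n => e (pathWalk s 1 n)) 1).symm
  rw [h]
  simp only [pathWalk_succ', he, convergingTo, Set.mem_ofPred_eq]
  constructor
  · intro h
    simpa using h.const_smul (s 0)⁻¹
  · intro h
    simpa using h.const_smul (s 0)

variable [MeasurableSpace H] [DiscreteMeasurableSpace H] [Countable H]
  [FirstCountableTopology X]

theorem measurableSet_convergingTo (e : H → X) (z : X) :
    MeasurableSet (convergingTo e z) := by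
  borelize X
  exact measurableSet_tendsto (𝓝 z)
    fun n => (Measurable.of_discrete (f := e)).comp (measurable_pathWalk 1 n)

variable [MulAction H X] [ContinuousConstSMul H X] {e : H → X}
  (ν : Measure H) [IsProbabilityMeasure ν]

/-- Harmonicity of the hitting probabilities, by conditioning on the first increment. -/
theorem pathMeasure_convergingTo (he : ∀ g h, e (g * h) = g • e h) (z : X) :
    pathMeasure ν (convergingTo e z) =
      ∑' g, ν {g} * pathMeasure ν (convergingTo e (g⁻¹ • z)) := by
  have h : convergingTo e z =
      ⋃ g, {s : ℕ → H | s 0 = g ∧ shiftSeq 1 s ∈ convergingTo e (g⁻¹ • z)} := by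
    ext s
    rw [mem_convergingTo_iff he]
    simp
  rw [h, measure_iUnion]
  · simp_rw [pathMeasure_head_inter_tail ν _ (measurableSet_convergingTo e _)]
  · intro g g' hg
    refine Set.disjoint_left.2 fun s hs hs' => hg (hs.1.symm.trans hs'.1)
  · intro g
    exact (measurable_pi_apply 0 (measurableSet_singleton g)).inter
      (measurable_shiftSeq 1 (measurableSet_convergingTo e _))

open scoped Pointwise in
/-- The limit of a random walk in a space with infinite orbits has no atoms. -/
theorem pathMeasure_convergingTo_eq_zero [T2Space X] (he : ∀ g h, e (g * h) = g • e h)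
    (hν : Subgroup.closure {g | ν {g} ≠ 0} = ⊤)
    (horbit : ∀ z : X, (MulAction.orbit H z).Infinite) (z : X) :
    pathMeasure ν (convergingTo e z) = 0 := by
  set p : X → ENNReal := fun z => pathMeasure ν (convergingTo e z) with hp
  have hp1 : ∀ z, p z ≠ ⊤ := fun z => measure_ne_top _ _
  have hdisj : Pairwise (Function.onFun Disjoint (convergingTo e)) := fun z z' hz =>
    Set.disjoint_left.2 fun s hs hs' => hz (tendsto_nhds_unique hs hs')
  change p z = 0
  by_contra hz
  -- Convergence events for distinct limits are disjoint, so only finitely many have probability at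
  -- least `p z > 0`; the maximum is therefore attained.
  have hfin : {y | p z ≤ p y}.Finite :=
    Measure.finite_const_le_meas_of_disjoint_iUnion _ (pos_iff_ne_zero.2 hz)
      (measurableSet_convergingTo e) hdisj (measure_ne_top _ _)
  obtain ⟨w, hw, hmax⟩ := Set.exists_max_image _ p hfin ⟨z, le_refl (p z)⟩
  have hmax' : ∀ y, p y ≤ p w := fun y => by
    rcases le_total (p z) (p y) with h | h
    · exact hmax y h
    · exact h.trans hw
  set A : Set X := {y | p y = p w} with hA
  have hAfin : A.Finite := hfin.subset fun y hy => by
    simp only [hA, Set.mem_ofPred_eq] at hy ⊢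
    rw [hy]; exact hw
  have hsum : ∑' g, ν {g} = 1 := by
    rw [← measure_univ (μ := ν), ← Measure.tsum_indicator_apply_singleton ν _ .univ]
    simp
  have hinv : ∀ g, ν {g} ≠ 0 → ∀ y ∈ A, g⁻¹ • y ∈ A := by
    intro g hg y hy
    by_contra hlt
    have hlt' : p (g⁻¹ • y) < p w := lt_of_le_of_ne (hmax' _) hlt
    have h1 : ∑' g, ν {g} * p (g⁻¹ • y) = p w :=
      (pathMeasure_convergingTo ν he y).symm.trans hy
    have h2 : ∑' g, ν {g} * p (g⁻¹ • y) < ∑' g, ν {g} * p w := by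
      refine ENNReal.tsum_lt_tsum (i := g) (by rw [h1]; exact hp1 w)
        (fun g => by gcongr; exact hmax' _) ?_
      exact (ENNReal.mul_lt_mul_iff_right hg (measure_ne_top _ _)).2 hlt'
    rw [h1, ENNReal.tsum_mul_right, hsum, one_mul] at h2
    exact lt_irrefl _ h2
  -- As `A` is finite, mapping `A` into itself already means stabilising it, so the stabiliser
  -- contains a generating set.
  have hstab : ∀ g : H, g • w ∈ A := by
    have hle : Subgroup.closure {g | ν {g} ≠ 0} ≤ MulAction.stabilizer H A := by
      rw [Subgroup.closure_le]
      intro g hg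
      rw [SetLike.mem_coe, ← inv_mem_iff, MulAction.mem_stabilizer_set' hAfin]
      exact fun y hy => hinv g hg y hy
    intro g
    have hg : g ∈ MulAction.stabilizer H A := hle (hν ▸ Subgroup.mem_top g)
    exact (MulAction.mem_stabilizer_set' hAfin).1 hg (show p w = p w from rfl)
  exact horbit w (hAfin.subset (by rintro _ ⟨g, rfl⟩; exact hstab g))

end Atoms

/-! ### The word metric and tours -/

section WordMetric

variable {Γ : Type*} [Group Γ] {S : Set Γ}

theorem countable_of_closure_eq_top (hS : Subgroup.closure S = ⊤) [Countable S] :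
    Countable Γ := by
  have : Countable (FreeGroup S) := inferInstanceAs (Countable (Quot _))
  refine Function.Surjective.countable (f := FreeGroup.lift ((↑) : S → Γ)) ?_
  rw [← MonoidHom.range_eq_top, FreeGroup.range_lift_eq_closure, Subtype.range_coe, hS]

/-- `SimpleGraph.dist` is zero between disconnected vertices, so the triangle inequality rests on
this. -/
theorem mulCayley_connected (hS : Subgroup.closure S = ⊤) :
    (SimpleGraph.mulCayley S).Connected := by
  have h : ∀ x y : Γ, (SimpleGraph.mulCayley S).Reachable y (y * x) := by
    intro x
    refine Subgroup.closure_induction (k := S)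
      (p := fun x _ => ∀ y, (SimpleGraph.mulCayley S).Reachable y (y * x)) ?_ ?_ ?_ ?_
      (hS ▸ Subgroup.mem_top x)
    · intro x hx y
      by_cases hxy : y = y * x
      · rw [← hxy]
      · exact ((SimpleGraph.mulCayley_adj' S y (y * x)).2
          ⟨hxy, x, hx, Or.inl rfl⟩).reachable
    · intro y; simp
    · intro a b _ _ ha hb y
      rw [← mul_assoc]
      exact (ha y).trans (hb _)
    · intro a _ ha y
      simpa using (ha (y * a⁻¹)).symm
  exact ⟨fun x y => by simpa using h (x⁻¹ * y) x⟩

theorem wordDist_mul_left (hS : Subgroup.closure S = ⊤) (g x y : Γ) :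
    wordDist S (g * x) (g * y) = wordDist S x y := by
  have h : ∀ g x y : Γ, wordDist S (g * x) (g * y) ≤ wordDist S x y := by
    intro g x y
    let φ : SimpleGraph.mulCayley S →g SimpleGraph.mulCayley S :=
      ⟨fun z => g * z, fun h => SimpleGraph.mulCayley_adj_mul_iff_right.2 h⟩
    obtain ⟨p, hp⟩ := (mulCayley_connected hS).exists_walk_length_eq_dist x y
    rw [wordDist, wordDist, ← hp, ← p.length_map φ]
    exact SimpleGraph.dist_le _
  exact (h g x y).antisymm (by simpa using h g⁻¹ (g * x) (g * y))

theorem wordDist_comm (x y : Γ) : wordDist S x y = wordDist S y x := SimpleGraph.dist_comm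

theorem wordDist_triangle (hS : Subgroup.closure S = ⊤) (x y z : Γ) :
    wordDist S x z ≤ wordDist S x y + wordDist S y z :=
  (mulCayley_connected hS).dist_triangle

theorem isLength_wordDist (hS : Subgroup.closure S = ⊤) :
    IsLength fun x : Γ => (wordDist S 1 x : ℝ) where
  one := by simp [wordDist]
  nonneg _ := by positivity
  mul_le x y := by
    have h := wordDist_triangle hS 1 x (x * y)
    have h1 := wordDist_mul_left hS x 1 y
    rw [mul_one] at h1
    rw [h1] at h
    exact_mod_cast h
  inv x := by
    have h := wordDist_mul_left hS x 1 x⁻¹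
    rw [mul_one, mul_inv_cancel, wordDist_comm] at h
    rw [h]

theorem wordDist_le_tourLength (hS : Subgroup.closure S = ⊤) (x : Γ) (l : List Γ) :
    ∀ a ∈ x :: l, wordDist S x a ≤ tourLength S (x :: l) := by
  induction l generalizing x with
  | nil => simp [wordDist]
  | cons y l ih =>
    intro a ha
    rcases List.mem_cons.1 ha with rfl | ha
    · simp [wordDist]
    · exact (wordDist_triangle hS x y a).trans (Nat.add_le_add_left (ih y a ha) _)

theorem wordDist_le_travelLength (hS : Subgroup.closure S = ⊤) {A : Set Γ} (hA : A.Finite)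
    {x x' a : Γ} (ha : a ∈ A ∨ a = x') : wordDist S x a ≤ travelLength S A x x' := by
  -- Finiteness of `A` provides an admissible tour; otherwise the infimum would take the default
  -- value `0`.
  have hne : {n | ∃ l : List Γ, (∀ a ∈ A, a ∈ x :: (l ++ [x'])) ∧
      tourLength S (x :: (l ++ [x'])) = n}.Nonempty :=
    ⟨_, hA.toFinset.toList, fun a ha => by simp [ha], rfl⟩
  obtain ⟨l, hl, hlen⟩ := Nat.sInf_mem hne
  rw [travelLength, ← hlen]
  refine wordDist_le_tourLength hS x _ a ?_
  rcases ha with ha | rfl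
  · exact hl a ha
  · simp

end WordMetric

/-! ### Comparison of the word and lamplighter distances -/

section LampMetric

variable {Γ : Type*} [Group Γ] {S : Set Γ} {r : ℕ} {c : ℝ}

theorem isLength_wordDist_pos (hS : Subgroup.closure S = ⊤) :
    IsLength fun g : LampGroup r Γ => (wordDist S 1 g.pos : ℝ) where
  one := (isLength_wordDist hS).one
  nonneg _ := by positivity
  mul_le g h := (isLength_wordDist hS).mul_le g.pos h.pos
  inv g := (isLength_wordDist hS).inv g.pos

theorem lampDist_nonneg (hc : 0 ≤ c) (g h : LampGroup r Γ) : 0 ≤ lampDist S c g h := by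
  unfold lampDist; positivity

theorem wordDist_le_lampDist (hS : Subgroup.closure S = ⊤) (hc : 0 ≤ c) (g : LampGroup r Γ)
    {a : Γ} (ha : g.lamps a ≠ 0 ∨ a = g.pos) : (wordDist S 1 a : ℝ) ≤ lampDist S c 1 g := by
  have hA : {y | (1 : LampGroup r Γ).lamps y ≠ g.lamps y}.Finite :=
    g.lamps.hasFiniteSupport.subset fun y hy => by
      simpa [eq_comm] using hy
  have h := wordDist_le_travelLength hS hA (x := 1) (x' := g.pos) (a := a) (by
    simpa [eq_comm] using ha)
  have h' : (wordDist S 1 a : ℝ) ≤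
      travelLength S {y | (1 : LampGroup r Γ).lamps y ≠ g.lamps y} 1 g.pos := by exact_mod_cast h
  unfold lampDist
  have : 0 ≤ c * (Set.ncard {y | (1 : LampGroup r Γ).lamps y ≠ g.lamps y} : ℝ) := by positivity
  rw [one_pos]
  linarith

end LampMetric

/-! ### Stabilisation of the lamps and accumulation of the support -/

section LampWalk

variable {Γ : Type*} [Group Γ] {S : Set Γ} {r : ℕ} {c : ℝ}

theorem IsLength.eventually_le_pathWalk {H : Type*} [Group H] {L : H → ℝ} (hL : IsLength L)
    {s : ℕ → H} (h : LinearGrowth L s) (g : H) :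
    ∃ k : ℕ, ∀ᶠ n : ℕ in atTop, (n : ℝ) ≤ k * L (pathWalk s g n) := by
  obtain ⟨k, N, hk⟩ := h
  refine ⟨2 * k, ?_⟩
  filter_upwards [eventually_ge_atTop N, eventually_ge_atTop ⌈2 * k * L g⌉₊] with n hn hn'
  have h1 := hk n hn
  have h2 := hL.le_mul_add g (pathWalk s 1 n)
  rw [← pathWalk_eq_mul] at h2
  have h3 : 2 * k * L g ≤ n := Nat.ceil_le.1 hn'
  have h4 : (k : ℝ) * L (pathWalk s 1 n) ≤ k * (L (pathWalk s g n) + L g) := by gcongr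
  push_cast
  linarith

/-- A lamp that changes lies in the translate by the current position of the increment's support,
and the increment's tour starts at the identity. -/
theorem wordDist_le_of_lamps_ne (hS : Subgroup.closure S = ⊤) (hc : 0 ≤ c)
    (s : ℕ → LampGroup r Γ) (g : LampGroup r Γ) (n : ℕ) (y : Γ)
    (h : (pathWalk s g (n + 1)).lamps y ≠ (pathWalk s g n).lamps y) :
    (wordDist S (pathWalk s g n).pos y : ℝ) ≤ lampDist S c 1 (s n) := by
  have h1 : (s n).lamps ((pathWalk s g n).pos⁻¹ * y) ≠ 0 := by
    intro h0
    exact h (by simp [pathWalk, h0])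
  have h2 := wordDist_le_lampDist hS hc (s n) (Or.inl h1)
  rwa [← wordDist_mul_left hS (pathWalk s g n).pos, mul_one, mul_inv_cancel_left] at h2

theorem finite_lamps_ne (s : ℕ → LampGroup r Γ) (g : LampGroup r Γ) (n : ℕ) :
    {y | (pathWalk s g (n + 1)).lamps y ≠ (pathWalk s g n).lamps y}.Finite := by
  refine ((pathWalk s g (n + 1)).lamps.hasFiniteSupport.union
    (pathWalk s g n).lamps.hasFiniteSupport).subset fun y hy => ?_
  by_contra hcon
  simp only [Set.mem_union, Function.mem_support, not_or, not_not] at hcon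
  exact hy (hcon.1.trans hcon.2.symm)

theorem eventually_lamps_eq (hS : Subgroup.closure S = ⊤) (hc : 0 ≤ c)
    {s : ℕ → LampGroup r Γ} (g : LampGroup r Γ)
    (hstep : Tendsto (fun n : ℕ => lampDist S c 1 (s n) / n) atTop (𝓝 0))
    (hgrowth : LinearGrowth (fun g : LampGroup r Γ => (wordDist S 1 g.pos : ℝ)) s) (y : Γ) :
    ∀ᶠ n in atTop, (pathWalk s g (n + 1)).lamps y = (pathWalk s g n).lamps y := by
  obtain ⟨k, hk⟩ := (isLength_wordDist_pos hS).eventually_le_pathWalk hgrowth g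
  -- Chosen so that `k δ ≤ 1/2`: a change at `y` would force `n ≤ k d(e, y) + n/2`, false once `n >
  -- 2k d(e, y)`.
  have hδ : (0 : ℝ) < 1 / (2 * (k + 1)) := by positivity
  filter_upwards [hk, hstep.eventually (gt_mem_nhds hδ), eventually_gt_atTop 0,
    eventually_gt_atTop (2 * k * wordDist S 1 y)] with n h1 h2 h3 h4
  by_contra hne
  have h5 := wordDist_le_of_lamps_ne hS hc s g n y hne
  have h6 : (wordDist S 1 (pathWalk s g n).pos : ℝ) ≤
      wordDist S 1 y + wordDist S (pathWalk s g n).pos y := by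
    have := wordDist_triangle hS 1 y (pathWalk s g n).pos
    rw [wordDist_comm y] at this
    exact_mod_cast this
  have hn : (0 : ℝ) < n := by exact_mod_cast h3
  rw [div_lt_iff₀ hn] at h2
  have h7 : (2 * k * wordDist S 1 y : ℝ) < n := by exact_mod_cast h4
  have h8 : (wordDist S 1 (pathWalk s g n).pos : ℝ) ≤
      wordDist S 1 y + 1 / (2 * (k + 1)) * n := by linarith
  have h9 : (k : ℝ) * wordDist S 1 (pathWalk s g n).pos ≤
      k * (wordDist S 1 y + 1 / (2 * (k + 1)) * n) := by gcongr
  have h10 : (k : ℝ) * (1 / (2 * (k + 1)) * n) ≤ n / 2 := by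
    have : (k : ℝ) * (1 / (2 * (k + 1)) * n) = (k / (k + 1)) * (n / 2) := by field_simp
    rw [this]
    have h11 : (k : ℝ) / (k + 1) ≤ 1 := by rw [div_le_one (by positivity)]; linarith
    nlinarith
  linarith

variable {Γhat : Type*} [TopologicalSpace Γhat] {ι : Γ → Γhat}

theorem mapClusterPt_of_lamps (hS : Subgroup.closure S = ⊤) (hc : 0 ≤ c)
    (hCP : ConvergenceProperty ι S) {s : ℕ → LampGroup r Γ} (g : LampGroup r Γ)
    (hstep : Tendsto (fun n : ℕ => lampDist S c 1 (s n) / n) atTop (𝓝 0))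
    (hgrowth : LinearGrowth (fun g : LampGroup r Γ => (wordDist S 1 g.pos : ℝ)) s)
    {u : Γhat} (hu : u ∈ boundary ι)
    (hconv : Tendsto (fun n => ι (pathWalk s g n).pos) atTop (𝓝 u))
    {ζ : Γ → ZMod r} (hζ : ∀ y, ∀ᶠ n in atTop, (pathWalk s g n).lamps y = ζ y)
    {y : ℕ → Γ} (hy : Tendsto y atTop cofinite) (hyζ : ∀ᶠ j in atTop, ζ (y j) ≠ 0) :
    MapClusterPt u atTop (ι ∘ y) := by
  obtain ⟨k, hk⟩ := (isLength_wordDist_pos hS).eventually_le_pathWalk hgrowth g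
  have hchange : ∀ x, ζ x ≠ 0 → g.lamps x = 0 →
      ∃ n, (pathWalk s g (n + 1)).lamps x ≠ (pathWalk s g n).lamps x := by
    intro x hx hg
    by_contra! hcon
    have h0 : ∀ n, (pathWalk s g n).lamps x = 0 := by
      intro n
      induction n with
      | zero => exact hg
      | succ n ih => rw [hcon, ih]
    obtain ⟨n, hn⟩ := (hζ x).exists
    exact hx (hn.symm.trans (h0 n))
  have hg : ∀ᶠ j in atTop, g.lamps (y j) = 0 := by
    filter_upwards [hy.eventually g.lamps.hasFiniteSupport.compl_mem_cofinite] with j hj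
    simpa using hj
  have hex : ∀ j, ∃ n, ζ (y j) ≠ 0 → g.lamps (y j) = 0 →
      (pathWalk s g (n + 1)).lamps (y j) ≠ (pathWalk s g n).lamps (y j) := by
    intro j
    by_cases h : ζ (y j) ≠ 0 ∧ g.lamps (y j) = 0
    · obtain ⟨n, hn⟩ := hchange _ h.1 h.2
      exact ⟨n, fun _ _ => hn⟩
    · exact ⟨0, fun h1 h2 => absurd ⟨h1, h2⟩ h⟩
  choose N hN using hex
  have hN' : ∀ᶠ j in atTop,
      (pathWalk s g (N j + 1)).lamps (y j) ≠ (pathWalk s g (N j)).lamps (y j) := by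
    filter_upwards [hyζ, hg] with j h1 h2 using hN j h1 h2
  -- Only finitely many lamps change before any given time, whereas `y` leaves every finite set.
  have hNtop : Tendsto N atTop atTop := by
    refine tendsto_atTop.2 fun m => ?_
    have hfin : (⋃ n ∈ Finset.range m,
        {x | (pathWalk s g (n + 1)).lamps x ≠ (pathWalk s g n).lamps x}).Finite :=
      (Finset.range m).finite_toSet.biUnion fun n _ => finite_lamps_ne s g n
    filter_upwards [hN', hy.eventually hfin.compl_mem_cofinite] with j h1 h2
    by_contra hlt
    exact h2 (Set.mem_biUnion (Finset.mem_coe.2 (Finset.mem_range.2 (not_le.1 hlt))) h1)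
  have hgood : ∀ᶠ j in atTop, (pathWalk s g (N j)).pos ≠ 1 ∧
      (wordDist S (pathWalk s g (N j)).pos (y j) : ℝ) / wordDist S (pathWalk s g (N j)).pos 1 ≤
        k * (lampDist S c 1 (s (N j)) / N j) := by
    filter_upwards [hN', hNtop.eventually hk, hNtop.eventually_gt_atTop 0] with j h1 h2 h3
    have h4 := wordDist_le_of_lamps_ne hS hc s g (N j) (y j) h1
    have h5 : (0 : ℝ) < N j := by exact_mod_cast h3
    have h6 : (0 : ℝ) < wordDist S 1 (pathWalk s g (N j)).pos := by
      by_contra hle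
      have : (k : ℝ) * wordDist S 1 (pathWalk s g (N j)).pos ≤ 0 :=
        mul_nonpos_of_nonneg_of_nonpos (by positivity) (not_lt.1 hle)
      linarith
    refine ⟨fun h => ?_, ?_⟩
    · rw [h] at h6
      simp [wordDist] at h6
    · rw [wordDist_comm _ 1, div_le_iff₀ h6]
      have h7 : 0 ≤ lampDist S c 1 (s (N j)) / N j :=
        div_nonneg (lampDist_nonneg hc _ _) h5.le
      calc (wordDist S (pathWalk s g (N j)).pos (y j) : ℝ) ≤ lampDist S c 1 (s (N j)) := h4
        _ = lampDist S c 1 (s (N j)) / N j * N j := (div_mul_cancel₀ _ h5.ne').symm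
        _ ≤ lampDist S c 1 (s (N j)) / N j *
            (k * wordDist S 1 (pathWalk s g (N j)).pos) := by gcongr
        _ = _ := by ring
  -- (CP) demands `x_n ≠ e` for all `n`, so an initial segment is discarded.
  obtain ⟨J, hJ⟩ := eventually_atTop.1 hgood
  have hJtop : Tendsto (fun j => j + J) atTop atTop := tendsto_add_atTop_nat J
  have hlim := ((hstep.comp hNtop).const_mul (k : ℝ)).comp hJtop
  rw [mul_zero] at hlim
  have h := hCP (fun j => (pathWalk s g (N (j + J))).pos) (fun j => y (j + J)) u hu
    (fun j => (hJ _ (by omega)).1) ((hconv.comp hNtop).comp hJtop).mapClusterPt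
    (squeeze_zero (fun j => by positivity) (fun j => (hJ (j + J) (by omega)).2) hlim)
  exact MapClusterPt.of_comp (u := ι ∘ y) hJtop h

/-- Along a good sequence of increments the lamps stabilise, and the limiting configuration can
accumulate only at the limit of the positions. -/
theorem exists_limit_config [T2Space Γhat] [FirstCountableTopology Γhat]
    (hS : Subgroup.closure S = ⊤) (hc : 0 ≤ c)
    (hCP : ConvergenceProperty ι S) {s : ℕ → LampGroup r Γ} (g : LampGroup r Γ)
    (hι : Function.Injective ι)
    (hstep : Tendsto (fun n : ℕ => lampDist S c 1 (s n) / n) atTop (𝓝 0))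
    (hgrowth : LinearGrowth (fun g : LampGroup r Γ => (wordDist S 1 g.pos : ℝ)) s)
    {u : Γhat} (hu : u ∈ boundary ι)
    (hconv : Tendsto (fun n => ι (pathWalk s g n).pos) atTop (𝓝 u)) :
    ∃ ζ ∈ configsAt ι r u, ∀ y, ∀ᶠ n in atTop, (pathWalk s g n).lamps y = ζ y := by
  have hex : ∀ y, ∃ a, ∀ᶠ n in atTop, (pathWalk s g n).lamps y = a := by
    intro y
    obtain ⟨N, hN⟩ := eventually_atTop.1 (eventually_lamps_eq hS hc g hstep hgrowth y)
    refine ⟨(pathWalk s g N).lamps y, eventually_atTop.2 ⟨N, fun n hn => ?_⟩⟩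
    induction n, hn using Nat.le_induction with
    | base => rfl
    | succ n hn ih => rw [hN n hn, ih]
  choose ζ hζ using hex
  refine ⟨ζ, ?_, hζ⟩
  have key : ∀ y : ℕ → Γ, Tendsto y atTop cofinite → (∀ᶠ j in atTop, ζ (y j) ≠ 0) →
      MapClusterPt u atTop (ι ∘ y) := fun y hy hyζ =>
    mapClusterPt_of_lamps hS hc hCP g hstep hgrowth hu hconv hζ hy hyζ
  rw [configsAt, Set.mem_ofPred_eq, or_iff_not_imp_left]
  intro hinf v
  constructor
  · intro hv
    have hne : (comap ι (𝓝[≠] v ⊓ 𝓟 (ι '' Function.support ζ))).NeBot := by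
      refine comap_neBot fun t ht => ?_
      obtain ⟨w, hwt, x, -, rfl⟩ := (hv : NeBot _).nonempty_of_mem
        (inter_mem ht (mem_inf_of_right (mem_principal_self _)))
      exact ⟨x, hwt⟩
    obtain ⟨y, hy⟩ := exists_seq_tendsto (comap ι (𝓝[≠] v ⊓ 𝓟 (ι '' Function.support ζ)))
    rw [tendsto_comap_iff, tendsto_inf] at hy
    have hyv : Tendsto (ι ∘ y) atTop (𝓝 v) := hy.1.mono_right inf_le_left
    have hyne : ∀ᶠ j in atTop, ι (y j) ≠ v := hy.1.eventually self_mem_nhdsWithin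
    -- A point equal to `v` is excluded by the punctured neighbourhood; any other point is
    -- eventually avoided because `ι ∘ y` tends to `v`.
    have hcof : Tendsto y atTop cofinite := by
      refine le_cofinite_iff_eventually_ne.2 fun x => ?_
      rw [eventually_map]
      by_cases hx : ι x = v
      · filter_upwards [hyne] with j hj h
        exact hj (h ▸ hx)
      · filter_upwards [hyv.eventually (isOpen_ne.mem_nhds (Ne.symm hx))] with j hj h
        exact hj (by simp [h])
    have hsupp : ∀ᶠ j in atTop, ζ (y j) ≠ 0 := by
      filter_upwards [tendsto_principal.1 hy.2] with j hj
      obtain ⟨x, hx, hxj⟩ := hj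
      exact hι hxj ▸ hx
    have hcl := key y hcof hsupp
    have : (𝓝 v ⊓ 𝓝 u).NeBot := by
      rw [inf_comm]
      exact NeBot.mono hcl (inf_le_inf_left _ hyv)
    exact eq_of_nhds_neBot this
  · rintro rfl
    -- An injective enumeration of the infinite support clusters at the limit; this is a genuine
    -- accumulation point since boundary points are not in the range of `ι`.
    have hcl := key (fun j => (Set.Infinite.natEmbedding _ hinf j : Γ))
      (Nat.cofinite_eq_atTop ▸ (Subtype.val_injective.comp
        (Set.Infinite.natEmbedding _ hinf).injective).tendsto_cofinite)
      (.of_forall fun j => (Set.Infinite.natEmbedding _ hinf j).2)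
    rw [accPt_iff_frequently]
    rw [frequently_iff]
    intro U hU
    obtain ⟨j, hj⟩ := (hcl.frequently hU).exists
    exact ⟨_, hj, fun h => hu ⟨_, h⟩, _, (Set.Infinite.natEmbedding _ hinf j).2, rfl⟩

end LampWalk

/-! ### The lamplighter action on configurations and the extended space -/

section Action

variable {Γ Γhat : Type*} [Group Γ] [MulAction Γ Γhat] {r : ℕ}

/-- The action of the lamplighter group on configurations and points of the extended space:
`(η, x) • (ζ, u) = (η + T_x ζ, x • u)`. -/
instance lampAction : MulAction (LampGroup r Γ) ((Γ → ZMod r) × Γhat) where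
  smul g p := (fun y => g.lamps y + p.1 (g.pos⁻¹ * y), g.pos • p.2)
  one_smul p := by
    refine Prod.ext (funext fun y => ?_) (one_smul Γ p.2)
    change (0 : ZMod r) + p.1 (1⁻¹ * y) = p.1 y
    simp
  mul_smul g h p := by
    refine Prod.ext (funext fun y => ?_) (mul_smul g.pos h.pos p.2)
    change (g * h).lamps y + p.1 ((g * h).pos⁻¹ * y) =
      g.lamps y + (h.lamps (g.pos⁻¹ * y) + p.1 (h.pos⁻¹ * (g.pos⁻¹ * y)))
    simp [mul_assoc, add_assoc]

theorem lamp_smul_def (g : LampGroup r Γ) (p : (Γ → ZMod r) × Γhat) :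
    g • p = (fun y => g.lamps y + p.1 (g.pos⁻¹ * y), g.pos • p.2) := rfl

instance [TopologicalSpace Γhat] [ContinuousConstSMul Γ Γhat] :
    ContinuousConstSMul (LampGroup r Γ) ((Γ → ZMod r) × Γhat) where
  continuous_const_smul g := by
    simp only [lamp_smul_def]
    fun_prop

theorem embed_mul [TopologicalSpace Γhat] {ι : Γ → Γhat} (hι : IsExtendedSpace ι)
    (g h : LampGroup r Γ) : embed ι (g * h) = g • embed ι h := by
  refine Prod.ext (funext fun y => ?_) (hι.equivariant g.pos h.pos)
  simp [embed, lamp_smul_def]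

theorem infinite_lamp_orbit [Infinite Γ] [Nontrivial (ZMod r)] (z : (Γ → ZMod r) × Γhat) :
    (MulAction.orbit (LampGroup r Γ) z).Infinite := by
  refine Set.infinite_of_injective_forall_mem
    (f := fun x : Γ => (⟨Finsupp.single x 1, 1⟩ : LampGroup r Γ) • z) (fun x x' h => ?_)
    fun x => ⟨_, rfl⟩
  have h1 := congrFun (congrArg Prod.fst h) x
  simp only [lamp_smul_def, add_left_inj, Finsupp.single_eq_same] at h1
  by_contra hne
  rw [Finsupp.single_eq_of_ne hne] at h1
  exact one_ne_zero h1

end Action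

instance (r : ℕ) (Γ : Type*) : DiscreteMeasurableSpace (LampGroup r Γ) := ⟨fun _ => trivial⟩

theorem countable_lampGroup {r : ℕ} [NeZero r] {Γ : Type*} [Countable Γ] :
    Countable (LampGroup r Γ) :=
  Function.Injective.countable (f := fun g : LampGroup r Γ => (g.lamps, g.pos)) fun _ _ hgh =>
    LampGroup.ext (congrArg Prod.fst hgh) (congrArg Prod.snd hgh)

theorem FiniteFirstMoment.integrable {α : Type*} [MeasurableSpace α] [DiscreteMeasurableSpace α]
    [Countable α] {len : α → ℝ} (hlen : ∀ a, 0 ≤ len a) {p : PMF α}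
    (h : FiniteFirstMoment len p) : Integrable len p.toMeasure := by
  refine ⟨Measurable.of_discrete.aestronglyMeasurable, ?_⟩
  rw [hasFiniteIntegral_iff_enorm, lintegral_countable']
  have h1 : ∀ a, ‖len a‖ₑ * p.toMeasure {a} = ENNReal.ofReal (len a * (p a).toReal) := by
    intro a
    rw [p.toMeasure_apply_singleton a (measurableSet_singleton a), Real.enorm_of_nonneg (hlen a),
      ENNReal.ofReal_mul (hlen a), ENNReal.ofReal_toReal (p.apply_ne_top a)]
  simp_rw [h1]
  exact h.tsum_ofReal_lt_top

/-- If the positions converge almost surely to a random boundary point and the lamps stabilise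
almost surely, then the limits form a random element of the lamplighter boundary. -/
theorem exists_measurable_limit {r : ℕ} {Γ Γhat W : Type*} [Group Γ] [TopologicalSpace Γhat]
    [MeasurableSpace Γhat] {ι : Γ → Γhat} [MeasurableSpace W] {P : Measure W}
    {Z : ℕ → W → LampGroup r Γ} (hZ : ∀ n, Measurable (Z n)) {Xinf : W → boundary ι}
    (hX : Measurable Xinf)
    (hconv : ∀ᵐ ω ∂P, Tendsto (fun n => ι (Z n ω).pos) atTop (𝓝 (Xinf ω : Γhat)))
    (hlamps : ∀ᵐ ω ∂P, ∃ ζ ∈ configsAt ι r (Xinf ω : Γhat),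
      ∀ y, ∀ᶠ n in atTop, (Z n ω).lamps y = ζ y) :
    ∃ Zinf : W → lampBoundary ι r, Measurable Zinf ∧
      ∀ᵐ ω ∂P, Tendsto (fun n => embed ι (Z n ω)) atTop
        (𝓝 (Zinf ω : (Γ → ZMod r) × Γhat)) := by
  classical
  obtain ⟨T, hTae, hT, hTζ⟩ := hlamps.exists_measurable_mem
  -- Off the measurable full-measure set `T` the lamps are replaced by zero, which lies in every
  -- `configsAt`. The chosen `ζ` is then an everywhere pointwise limit of measurable maps, hence
  -- measurable.
  have hex : ∀ ω, ∃ ζ ∈ configsAt ι r (Xinf ω : Γhat),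
      ∀ y, ∀ᶠ n in atTop, (if ω ∈ T then (Z n ω).lamps y else 0) = ζ y := by
    intro ω
    by_cases hω : ω ∈ T
    · simpa [hω] using hTζ ω hω
    · exact ⟨0, Or.inl (by simp), fun y => by simp [hω]⟩
  choose ζ hζ hlim using hex
  refine ⟨fun ω => ⟨(ζ ω, Xinf ω), (Xinf ω).2, hζ ω⟩, ?_, ?_⟩
  · refine Measurable.subtype_mk ((measurable_pi_iff.2 fun y => ?_).prodMk hX.subtype_val)
    refine measurable_of_tendsto_metrizable
      (f := fun n ω => if ω ∈ T then (Z n ω).lamps y else 0) (fun n => ?_)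
      (tendsto_pi_nhds.2 fun ω => tendsto_nhds_of_eventually_eq (hlim ω y))
    exact Measurable.ite hT ((Measurable.of_discrete
      (f := fun g : LampGroup r Γ => g.lamps y)).comp (hZ n)) measurable_const
  · filter_upwards [hTae, hconv] with ω hω hconvω
    refine Tendsto.prodMk_nhds (tendsto_pi_nhds.2 fun y => ?_) hconvω
    refine tendsto_nhds_of_eventually_eq ?_
    simpa [hω] using hlim ω y

end Lamplighter

end

/-! ### The main theorem -/

theorem mainTheorem2 {r : ℕ} (hr : 2 ≤ r)
    {Γ : Type*} [Group Γ] [Infinite Γ]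
    (S : Finset Γ) (hS : Subgroup.closure (S : Set Γ) = ⊤)
    {Γhat : Type*} [TopologicalSpace Γhat] [TopologicalSpace.MetrizableSpace Γhat]
    [MeasurableSpace Γhat] [BorelSpace Γhat] [MulAction Γ Γhat] [ContinuousConstSMul Γ Γhat]
    (ι : Γ → Γhat) (hι : Lamplighter.IsExtendedSpace ι)
    (c : ℝ) (hc : 0 < c)
    (μ : PMF (Lamplighter.LampGroup r Γ))
    (hμgen : Subgroup.closure μ.support = ⊤)
    (hμ : Lamplighter.FiniteFirstMoment (fun g => Lamplighter.lampDist (S : Set Γ) c 1 g) μ)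
    {W : Type*} [MeasurableSpace W] (P : Measure W) [IsProbabilityMeasure P]
    (ξ : ℕ → W → Lamplighter.LampGroup r Γ) (hξm : ∀ n, Measurable (ξ n))
    (hξindep : iIndepFun ξ P) (hξlaw : ∀ n, P.map (ξ n) = μ.toMeasure)
    (hbasic : Lamplighter.BasicAssumptions ι (S : Set Γ) P
      (μ.map Lamplighter.LampGroup.pos)
      (Lamplighter.randomWalk (Lamplighter.posIncrement ξ)))
    (hspeed : Lamplighter.PositiveRateOfEscape (S : Set Γ) P
      (Lamplighter.randomWalk (Lamplighter.posIncrement ξ) 1)) :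
    ∀ g : Lamplighter.LampGroup r Γ,
      ∃ Zinf : W → Lamplighter.lampBoundary ι r,
        Measurable Zinf ∧
        (∀ᵐ ω ∂P, Tendsto (fun n => Lamplighter.embed ι (Lamplighter.randomWalk ξ g n ω))
          atTop (𝓝 (Zinf ω : (Γ → ZMod r) × Γhat))) ∧
        ∀ z : Lamplighter.lampBoundary ι r, P.map Zinf {z} = 0 := by
  open Lamplighter in
  have : NeZero r := ⟨by omega⟩
  have : Fact (1 < r) := ⟨hr⟩
  have : Countable Γ := countable_of_closure_eq_top hS
  have : Countable (LampGroup r Γ) := countable_lampGroup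
  set ν := μ.toMeasure with hν
  set Q := pathMeasure ν with hQ
  set path : W → ℕ → LampGroup r Γ := fun ω k => ξ k ω with hpath
  have hpathm : Measurable path := measurable_pi_iff.2 hξm
  have hPQ : P.map path = Q := by
    rw [hpath, (iIndepFun_iff_map_fun_eq_infinitePi_map hξm).1 hξindep]
    simp_rw [hξlaw]
    rfl
  have hL : IsLength fun g : LampGroup r Γ => (wordDist (S : Set Γ) 1 g.pos : ℝ) :=
    isLength_wordDist_pos hS
  have hint : Integrable (fun g => lampDist (S : Set Γ) c 1 g) ν :=
    hμ.integrable fun g => lampDist_nonneg hc.le 1 g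
  have hLint : Integrable (fun g : LampGroup r Γ => (wordDist (S : Set Γ) 1 g.pos : ℝ)) ν :=
    hint.mono' Measurable.of_discrete.aestronglyMeasurable (.of_forall fun g => by
      rw [Real.norm_of_nonneg (hL.nonneg g)]
      exact wordDist_le_lampDist hS hc.le g (Or.inr rfl))
  have hwalk : ∀ g n ω, randomWalk ξ g n ω = pathWalk (path ω) g n :=
    fun g n ω => randomWalk_eq_pathWalk ξ g n ω
  have hgrowth : ∀ᵐ ω ∂P, LinearGrowth
      (fun g : LampGroup r Γ => (wordDist (S : Set Γ) 1 g.pos : ℝ)) (path ω) := by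
    obtain ⟨m, hm, hlim⟩ := hspeed
    refine ae_of_ae_map hpathm.aemeasurable ?_
    rw [hPQ]
    refine hL.ae_linearGrowth ν hLint hm (hlim.congr fun n => ?_)
    rw [← hQ, ← hPQ, integral_map (f := fun s => (wordDist (S : Set Γ) 1 (pathWalk s 1 n).pos : ℝ))
      hpathm.aemeasurable ((Measurable.of_discrete (f := fun g : LampGroup r Γ =>
        (wordDist (S : Set Γ) 1 g.pos : ℝ))).comp (measurable_pathWalk 1 n)).aestronglyMeasurable]
    congr 2 with ω
    rw [← hwalk, randomWalk_pos, Lamplighter.one_pos]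
  have hstep : ∀ᵐ ω ∂P,
      Tendsto (fun n : ℕ => lampDist (S : Set Γ) c 1 (path ω n) / n) atTop (𝓝 0) := by
    refine ae_of_ae_map (p := fun s : ℕ → LampGroup r Γ =>
      Tendsto (fun n : ℕ => lampDist (S : Set Γ) c 1 (s n) / n) atTop (𝓝 0))
      hpathm.aemeasurable ?_
    rw [hPQ]
    exact ae_tendsto_coordinate_div ν hint
  intro g
  obtain ⟨Xinf, hXm, hX⟩ := hbasic.converges g.pos
  have hX' : ∀ᵐ ω ∂P, Tendsto (fun n => ι (randomWalk ξ g n ω).pos) atTop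
      (𝓝 (Xinf ω : Γhat)) := by
    simpa only [randomWalk_pos] using hX
  have hZ : ∀ n, Measurable (randomWalk ξ g n) := fun n => by
    have h := (measurable_pathWalk g n).comp hpathm
    exact (funext fun ω => hwalk g n ω : randomWalk ξ g n = _) ▸ h
  obtain ⟨Zinf, hZm, hZlim⟩ := exists_measurable_limit hZ hXm hX' (by
    filter_upwards [hX', hgrowth, hstep] with ω h1 h2 h3
    simp only [hwalk] at h1 ⊢
    exact exists_limit_config hS hc.le hbasic.convergence_property g hι.injective h3 h2
      (Xinf ω).2 h1)
  refine ⟨Zinf, hZm, hZlim, fun z => ?_⟩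
  -- The walk from `g` converges to `z` exactly when the walk from the identity, with the same
  -- increments, converges to `g⁻¹ • z`.
  have hnull : Q (convergingTo (embed ι) (g⁻¹ • (z : (Γ → ZMod r) × Γhat))) = 0 := by
    refine pathMeasure_convergingTo_eq_zero ν (embed_mul hι) ?_ infinite_lamp_orbit _
    rw [← hμgen]
    congr 1
    ext h
    rw [Set.mem_ofPred_eq, hν, μ.toMeasure_apply_singleton h (measurableSet_singleton h),
      PMF.mem_support_iff]
  rw [← hPQ, Measure.map_apply hpathm (measurableSet_convergingTo _ _)] at hnull
  rw [Measure.map_apply hZm (measurableSet_singleton z)]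
  refine measure_mono_null_ae ?_ hnull
  filter_upwards [hZlim] with ω hω hz
  have hz' : Zinf ω = z := hz
  rw [hz'] at hω
  have h := hω.const_smul g⁻¹
  simp only [hwalk, ← embed_mul hι] at h
  change Tendsto (fun n => embed ι (pathWalk (path ω) 1 n)) atTop (𝓝 _)
  simpa [pathWalk_eq_mul _ g] using h
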